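/- Let $G=(V,E)$ be a finite undirected graph (loops and multiple edges allowed) and let $A,B\subseteq V^2$ be arbitrary sets of ordered pairs of vertices. An orientation of $G$ chooses one of the two directions of every edge (loops also have two directions). A subgraph of $G$ is a graph $(V,F)$ with $F\subseteq E$; it is a forest if it contains no cycle (a loop is a cycle). For an orientation $\omega$ (resp. a subgraph $(V,F)$) let $\vec G$ be the digraph on $V$ formed by the arcs of $\omega$ (resp. by two opposite arcs for every edge in $F$) together with the pairs in $A$ and in $B$ as additional arcs. The orientation (resp. subgraph) is *$(A,B)$-valid* if (a) for all $(u,v)\in A$, $v$ cannot reach $u$ by a directed path of $\vec G$, and (b) for all $(u,v)\in B$, $v$ can reach $u$ by a directed path of $\vec G$ (a vertex reaches itself by the path of length $0$). An *$(A,B)$-cocycle* of an orientation $\omega$ is a non-empty set of arcs of $\vec G$, none of them from $A\cup B$, which for some partition $V=V_1\cup V_2$ is the set of all arcs of $\vec G$ from $V_1$ to $V_2$, where $\vec G$ has no arc from $V_2$ to $V_1$. Two orientations are *cycle* (resp. *cocycle*, *cycle-cocycle*) *equivalent* if one is obtained from the other by repeatedly reversing all the edges of a directed cycle of the current orientation (resp.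 of an $(A,B)$-cocycle, of a directed cycle or an $(A,B)$-cocycle). A subgraph $(V,F)$ is *$(A,B)$-connected* if adding the edges $\{u,v\}$, $(u,v)\in A\cup B$, to $(V,F)$ and to $G$ yields two graphs with the same connected components. Then: (i) the number of cycle equivalence classes of $(A,B)$-valid orientations of $G$ equals the number of $(A,B)$-valid forests of $G$; (ii) the number of cocycle equivalence classes of $(A,B)$-valid orientations of $G$ equals the number of $(A,B)$-valid $(A,B)$-connected subgraphs of $G$; (iii) the number of cycle-cocycle equivalence classes of $(A,B)$-valid orientations of $G$ equals the number of $(A,B)$-valid $(A,B)$-connected forests of $G$. In particular, for $A=B=\emptyset$: the number of cycle equivalence classes of orientations of $G$ equals the number of forests of $G$; and, if $G$ is connected, the number of cocycle (resp. cycle-cocycle) equivalence classes of orientations of $G$ equals the number of connected subgraphs (resp. spanning trees) of $G$. -/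

import Mathlib

open scoped Graph

namespace Graph

variable {α β : Type*} {G : Graph α β}

/-- A conventional orientation of a multigraph: for every edge, a choice of which of its two ends is
called the tail and which the head. It only serves to name the two directions of an edge (in
particular, a loop has two directions as well). -/
structure RefOrientation (G : Graph α β) where
  /-- the conventional tail of an edge -/
  tail : E(G) → V(G)
  /-- the conventional head of an edge -/
  head : E(G) → V(G)
  isLink : ∀ e : E(G), G.IsLink e (tail e) (head e)

/-- Every multigraph has a conventional orientation. -/
instance : Nonempty (RefOrientation G) := by
  have h : ∀ e : E(G), ∃ p : V(G) × V(G), G.IsLink e p.1 p.2 := by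
    rintro ⟨e, he⟩
    obtain ⟨x, y, hxy⟩ := exists_isLink_of_mem_edgeSet he
    exact ⟨(⟨x, hxy.left_mem⟩, ⟨y, hxy.right_mem⟩), hxy⟩
  choose p hp using h
  exact ⟨⟨fun e => (p e).1, fun e => (p e).2, hp⟩⟩

/-- An arc of `G`: an edge with one of its two directions, `true` being the conventional one. -/
abbrev Arc (G : Graph α β) := E(G) × Bool

/-- An orientation of `G`: one direction for every edge (so there are `2 ^ |E(G)|` of them). -/
abbrev Orientation (G : Graph α β) := E(G) → Bool

/-- The arcs of an orientation. -/
def orientationArcs (ω : G.Orientation) : Set G.Arc := {a | ω a.1 = a.2}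

/-- The arcs of the subgraph `(V(G), F)`, each edge being replaced by two opposite arcs. -/
def subgraphArcs (F : Set E(G)) : Set G.Arc := {a | a.1 ∈ F}

open Classical in
/-- The orientation obtained from `ω` by reversing the edges in `X`. -/
noncomputable def reverse (ω : G.Orientation) (X : Set E(G)) : G.Orientation :=
  fun e => if e ∈ X then !(ω e) else ω e

/-- `u` and `v` are adjacent in the undirected graph obtained from the subgraph `(V(G), F)` by
adding an edge `{x, y}` for every pair `(x, y)` in `A ∪ B`. -/
def AdjAdd (A B : Set (V(G) × V(G))) (F : Set E(G)) (u v : V(G)) : Prop :=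
  (∃ e ∈ F, G.IsLink e u v) ∨ (u, v) ∈ A ∪ B ∨ (v, u) ∈ A ∪ B

/-- The subgraph `(V(G), F)` is `(A, B)`-connected: adding the edges of `A ∪ B` to it and to `G`
gives two graphs with the same connected components. -/
def IsABConnected (A B : Set (V(G) × V(G))) (F : Set E(G)) : Prop :=
  ∀ u v : V(G), Relation.ReflTransGen (AdjAdd A B F) u v ↔
    Relation.ReflTransGen (AdjAdd A B Set.univ) u v

/-- The subgraph `(V(G), F)` is connected (in the ordinary sense). -/
def IsConnectedSubgraph (F : Set E(G)) : Prop :=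
  Nonempty V(G) ∧
    ∀ u v : V(G), Relation.ReflTransGen (fun x y : V(G) => ∃ e ∈ F, G.IsLink e x y) u v

namespace RefOrientation

variable (o : G.RefOrientation)

/-- The initial vertex of an arc. -/
def src (a : G.Arc) : V(G) := if a.2 then o.tail a.1 else o.head a.1

/-- The terminal vertex of an arc. -/
def tgt (a : G.Arc) : V(G) := if a.2 then o.head a.1 else o.tail a.1

/-- There is an arc from `u` to `v` in the digraph with arc set `D` together with the pairs in `A`
and `B` as additional arcs. -/
def Step (A B : Set (V(G) × V(G))) (D : Set G.Arc) (u v : V(G)) : Prop :=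
  (∃ a ∈ D, o.src a = u ∧ o.tgt a = v) ∨ (u, v) ∈ A ∨ (u, v) ∈ B

/-- `u` can reach `v` by a directed path in that digraph. -/
def Reach (A B : Set (V(G) × V(G))) (D : Set G.Arc) : V(G) → V(G) → Prop :=
  Relation.ReflTransGen (o.Step A B D)

/-- The digraph with arc set `D` is `(A, B)`-valid: the head of a pair in `A` can never reach its
tail, and the head of a pair in `B` can always reach its tail. -/
def IsValid (A B : Set (V(G) × V(G))) (D : Set G.Arc) : Prop :=
  (∀ u v, (u, v) ∈ A → ¬ o.Reach A B D v u) ∧ (∀ u v, (u, v) ∈ B → o.Reach A B D v u)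

/-- The cyclic sequence of arcs `c 0, …, c n` traverses a cycle of `G`: consecutive arcs match
(cyclically), and no vertex and no edge is repeated. Loops are the cycles of length one. -/
def IsCycle {n : ℕ} (c : Fin (n + 1) → G.Arc) : Prop :=
  (∀ i, o.tgt (c i) = o.src (c (i + 1))) ∧
    Function.Injective (fun i => o.src (c i)) ∧ Function.Injective (fun i => (c i).1)

/-- The subgraph `(V(G), F)` is a forest: it contains no cycle of `G`. -/
def IsForest (F : Set E(G)) : Prop :=
  ¬ ∃ (n : ℕ) (c : Fin (n + 1) → G.Arc), o.IsCycle c ∧ ∀ i, (c i).1 ∈ F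

/-- `X` is the edge set of a directed cycle of the orientation `ω`. -/
def IsDirectedCycle (ω : G.Orientation) (X : Set E(G)) : Prop :=
  ∃ (n : ℕ) (c : Fin (n + 1) → G.Arc), o.IsCycle c ∧ (∀ i, c i ∈ orientationArcs ω) ∧
    X = Set.range (fun i => (c i).1)

/-- `X` is the edge set of an `(A, B)`-cocycle of the orientation `ω`: there is a partition
`V(G) = U ∪ Uᶜ` such that the digraph obtained from `ω` by adding the arcs in `A` and `B` has no
arc from `Uᶜ` to `U`, its set of arcs from `U` to `Uᶜ` is not empty and contains no arc of `A` or
`B`, and `X` is the set of edges of `G` underlying that set of arcs. -/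
def IsABCocycle (A B : Set (V(G) × V(G))) (ω : G.Orientation) (X : Set E(G)) : Prop :=
  X.Nonempty ∧ ∃ U : Set V(G),
    X = {e | ∃ a ∈ orientationArcs ω, a.1 = e ∧ o.src a ∈ U ∧ o.tgt a ∉ U} ∧
    (∀ a ∈ orientationArcs ω, ¬ (o.src a ∉ U ∧ o.tgt a ∈ U)) ∧
    (∀ p ∈ A ∪ B, ¬ (p.1 ∉ U ∧ p.2 ∈ U)) ∧
    (∀ p ∈ A ∪ B, ¬ (p.1 ∈ U ∧ p.2 ∉ U))

/-- `ω'` is obtained from `ω` by reversing one directed cycle. -/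
def CycleReversal (ω ω' : G.Orientation) : Prop :=
  ∃ X, o.IsDirectedCycle ω X ∧ ω' = reverse ω X

/-- `ω'` is obtained from `ω` by reversing one `(A, B)`-cocycle. -/
def CocycleReversal (A B : Set (V(G) × V(G))) (ω ω' : G.Orientation) : Prop :=
  ∃ X, o.IsABCocycle A B ω X ∧ ω' = reverse ω X

/-- `ω'` is obtained from `ω` by reversing one directed cycle or one `(A, B)`-cocycle. -/
def CycleCocycleReversal (A B : Set (V(G) × V(G))) (ω ω' : G.Orientation) : Prop :=
  o.CycleReversal ω ω' ∨ o.CocycleReversal A B ω ω'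

theorem reverse_reverse (ω : G.Orientation) (X : Set E(G)) :
    reverse (reverse ω X) X = ω := by
  funext e
  by_cases h : e ∈ X <;> simp [reverse, h]

theorem cycleReversal_symm {ω ω' : G.Orientation} (h : o.CycleReversal ω ω') :
    o.CycleReversal ω' ω := by
  obtain ⟨X, ⟨n, c, ⟨h1, h2, h3⟩, h4, rfl⟩, rfl⟩ := h
  have hs : ∀ a : G.Arc, o.src (a.1, !a.2) = o.tgt a := by
    rintro ⟨e, _ | _⟩ <;> simp [src, tgt]
  have ht : ∀ a : G.Arc, o.tgt (a.1, !a.2) = o.src a := by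
    rintro ⟨e, _ | _⟩ <;> simp [src, tgt]
  refine ⟨_, ⟨n, fun i => ((c (-i)).1, !(c (-i)).2), ⟨?_, ?_, ?_⟩, ?_, ?_⟩,
    (reverse_reverse _ _).symm⟩
  · intro i
    rw [ht, hs, h1]
    congr 2
    abel
  · intro i j hij
    simp only [hs, h1] at hij
    simpa using h2 hij
  · intro i j hij
    simpa using h3 hij
  · intro i
    have := h4 (-i)
    simp only [orientationArcs, Set.mem_ofPred_eq] at this ⊢
    simp [reverse, this]
  · ext e
    constructor
    · rintro ⟨i, rfl⟩
      exact ⟨-i, by simp⟩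
    · rintro ⟨i, rfl⟩
      exact ⟨-i, rfl⟩

theorem cocycleReversal_symm (A B : Set (V(G) × V(G))) {ω ω' : G.Orientation}
    (h : o.CocycleReversal A B ω ω') : o.CocycleReversal A B ω' ω := by
  obtain ⟨X, ⟨hX, U, hU, h1, h2, h3⟩, rfl⟩ := h
  have hs : ∀ e b, o.src (e, !b) = o.tgt (e, b) := by
    rintro e (_ | _) <;> simp [src, tgt]
  have ht : ∀ e b, o.tgt (e, !b) = o.src (e, b) := by
    rintro e (_ | _) <;> simp [src, tgt]
  have hm : ∀ e, e ∈ X ↔ o.src (e, ω e) ∈ U ∧ o.tgt (e, ω e) ∉ U := by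
    intro e
    rw [hU]
    constructor
    · rintro ⟨⟨e', b⟩, hb, rfl, h⟩
      have hb : ω e' = b := hb
      subst hb
      exact h
    · exact fun h => ⟨(e, ω e), rfl, rfl, h⟩
  have hn : ∀ e, ¬ (o.src (e, ω e) ∉ U ∧ o.tgt (e, ω e) ∈ U) := fun e => h1 (e, ω e) rfl
  refine ⟨X, ⟨hX, Uᶜ, ?_, ?_, ?_, ?_⟩, (reverse_reverse _ _).symm⟩
  · ext e
    constructor
    · intro he
      refine ⟨(e, reverse ω X e), rfl, rfl, ?_⟩
      have := (hm e).1 he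
      simp only [reverse, he, if_true, hs, ht, Set.mem_compl_iff, not_not]
      exact ⟨this.2, this.1⟩
    · rintro ⟨⟨e', b⟩, hb, rfl, h⟩
      have hb : reverse ω X e' = b := hb
      subst hb
      by_contra he
      simp only [reverse, he, if_false, Set.mem_compl_iff, not_not] at h
      exact hn _ h
  · rintro ⟨e, b⟩ hb h
    have hb : reverse ω X e = b := hb
    subst hb
    by_cases he : e ∈ X
    · simp only [reverse, he, if_true, hs, ht, Set.mem_compl_iff, not_not] at h
      exact hn _ ⟨h.2, h.1⟩
    · simp only [reverse, he, if_false, Set.mem_compl_iff, not_not] at h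
      exact he ((hm e).2 h)
  · intro p hp h
    simp only [Set.mem_compl_iff, not_not] at h
    exact h3 p hp h
  · intro p hp h
    simp only [Set.mem_compl_iff, not_not] at h
    exact h2 p hp h

/-- The equivalence relation whose classes are reached by repeating a symmetric elementary move. -/
def repeated {X : Type*} (r : X → X → Prop) (hr : ∀ {x y}, r x y → r y x) : Setoid X where
  r := Relation.ReflTransGen r
  iseqv := ⟨fun _ => .refl, fun h => by
    induction h with
    | refl => exact .refl
    | tail _ hyz ih => exact .head (hr hyz) ih, fun h h' => h.trans h'⟩

/-- Cycle equivalence: one orientation is obtained from the other by repeatedly reversing directed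
cycles. -/
def cycleEquiv : Setoid G.Orientation :=
  repeated o.CycleReversal o.cycleReversal_symm

/-- Cocycle equivalence: one orientation is obtained from the other by repeatedly reversing
`(A, B)`-cocycles. -/
def cocycleEquiv (A B : Set (V(G) × V(G))) : Setoid G.Orientation :=
  repeated (o.CocycleReversal A B) (o.cocycleReversal_symm A B)

/-- Cycle-cocycle equivalence: one orientation is obtained from the other by repeatedly reversing
directed cycles and/or `(A, B)`-cocycles. -/
def cycleCocycleEquiv (A B : Set (V(G) × V(G))) : Setoid G.Orientation :=
  repeated (o.CycleCocycleReversal A B)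
    (fun h => h.imp o.cycleReversal_symm (o.cocycleReversal_symm A B))

/-- The `(A, B)`-valid orientations of `G`. -/
abbrev ValidOrientation (A B : Set (V(G) × V(G))) :=
  {ω : G.Orientation // o.IsValid A B (orientationArcs ω)}

/-- The number of equivalence classes of `(A, B)`-valid orientations under an equivalence relation
between orientations. -/
noncomputable def numValidClasses (A B : Set (V(G) × V(G))) (s : Setoid G.Orientation) : ℕ :=
  Nat.card (Quotient (s.comap (Subtype.val : o.ValidOrientation A B → G.Orientation)))

end RefOrientation

end Graph

/-!
Order the edges and compare orientations lexicographically, a conventional direction being the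
larger one. If `ω` is largest in its class, then it is reduced: the least edge of any directed cycle
(cocycle) is directed conventionally. Conversely, let `ω` be reduced and `ω'` in the class of `ω`.
Reversing a directed cycle adds a flow to an orientation and reversing an `(A, B)`-cocycle adds a
tension, so `ω' - ω` is the sum of a flow and a tension; as its values are in `{-1, 0, 1}`, the
orthogonality of flows and tensions forces these to have disjoint supports, and then reducedness
makes both vanish at the first edge where `ω'` could exceed `ω`. So the classes correspond to the
reduced valid orientations.

Validity and reducedness make sense for arbitrary sets of arcs, in particular for subgraphs (both or
no arcs of each edge), where being reduced means being a forest or `(A, B)`-connected, respectively.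
Going through the edges in increasing order, one trades both or no arcs of an edge `e` for a single
one. All the properties involved are about reachability in minors that form a chain under inclusion,
hence `e` has a direction `b` such that adding `(e, b)` affects none of them, whether or not the
opposite arc is present: no arc of `e` is traded for `(e, b)`, and both are traded for the opposite
arc.
-/

open Relation Set

section Relations

variable {V : Type*} {R R₁ R₂ : V → V → Prop} {s t x y : V}

/-- The digraph whose only arc leads from `s` to `t`, used to add an arc to another digraph. -/
def singleArc (s t : V) : V → V → Prop := fun x y => x = s ∧ y = t

theorem reflTransGen_sup_singleArc :
    ReflTransGen (R ⊔ singleArc s t) x y ↔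
      ReflTransGen R x y ∨ ReflTransGen R x s ∧ ReflTransGen R t y := by
  have hR : ReflTransGen R ≤ ReflTransGen (R ⊔ singleArc s t) := ReflTransGen.mono le_sup_left
  constructor
  · intro h
    induction h with
    | refl => exact .inl .refl
    | tail _ hbc ih =>
      rcases hbc with hbc | ⟨rfl, rfl⟩
      · exact ih.imp (·.tail hbc) (And.imp_right (·.tail hbc))
      · exact .inr ⟨ih.elim id And.left, .refl⟩
  · rintro (h | ⟨hxs, hty⟩)
    · exact hR _ _ h
    · exact ((hR _ _ hxs).tail (.inr ⟨rfl, rfl⟩)).trans (hR _ _ hty)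

theorem reflTransGen_sup_singleArc_self :
    ReflTransGen (R ⊔ singleArc s t) t s ↔ ReflTransGen R t s := by
  rw [reflTransGen_sup_singleArc, and_self, or_self]

theorem reflTransGen_iff_of_le_sup_singleArc (h₀ : R ≤ R₁) (h₁ : R₁ ≤ R ⊔ singleArc t s)
    (h₁₂ : R₁ ≤ R₂) (h₂ : R₂ ≤ R₁ ⊔ singleArc s t)
    (hst : ReflTransGen R t s → ReflTransGen R s t) (hxy : R x y) :
    ReflTransGen R₂ y x ↔ ReflTransGen R₁ y x := by
  refine ⟨fun h => ?_, ReflTransGen.mono h₁₂ y x⟩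
  have lift {a b : V} : ReflTransGen R a b → ReflTransGen R₁ a b := ReflTransGen.mono h₀ a b
  rcases reflTransGen_sup_singleArc.1 (ReflTransGen.mono h₂ _ _ h) with h | ⟨hys, htx⟩
  · exact h
  rcases reflTransGen_sup_singleArc.1 (ReflTransGen.mono h₁ _ _ hys) with hys' | ⟨hyt, -⟩
  · rcases reflTransGen_sup_singleArc.1 (ReflTransGen.mono h₁ _ _ htx) with htx' | ⟨-, hsx⟩
    · have hts : ReflTransGen R t s := (htx'.tail hxy).trans hys'
      exact hys.trans ((lift (hst hts)).trans htx)
    · exact hys.trans (lift hsx)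
  · exact (lift hyt).trans htx

theorem forall_reflTransGen_imp_or_of_isChain {𝓡 : Set (V → V → Prop)}
    (h𝓡 : IsChain (· ≤ ·) 𝓡) (s t : V) :
    (∀ R ∈ 𝓡, ReflTransGen R s t → ReflTransGen R t s) ∨
      ∀ R ∈ 𝓡, ReflTransGen R t s → ReflTransGen R s t := by
  by_contra! ⟨⟨R, hR, hst, hts⟩, R', hR', hts', hst'⟩
  rcases h𝓡.total hR hR' with h | h
  · exact hst' (ReflTransGen.mono h _ _ hst)
  · exact hts (ReflTransGen.mono h _ _ hts')

theorem mem_of_reflTransGen {U : Set V} (hU : ∀ a b, R a b → b ∈ U → a ∈ U)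
    (h : ReflTransGen R x y) : y ∈ U → x ∈ U := by
  induction h with
  | refl => exact id
  | tail _ hbc ih => exact ih ∘ hU _ _ hbc

theorem reflTransGen_restrict {U : Set V} (hU : ∀ a b, R a b → b ∈ U → a ∈ U)
    (h : ReflTransGen R x y) (hxy : x ∈ U → y ∈ U) :
    ReflTransGen (fun a b => R a b ∧ (a ∈ U ↔ b ∈ U)) x y := by
  induction h with
  | refl => exact .refl
  | tail hxb hbc ih =>
    exact (ih (hU _ _ hbc ∘ hxy)).tail
      ⟨hbc, hxy ∘ mem_of_reflTransGen hU hxb, hU _ _ hbc⟩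

theorem exists_injOn_walk (h : ReflTransGen R x y) :
    ∃ (n : ℕ) (p : ℕ → V), p 0 = x ∧ p n = y ∧ (∀ i < n, R (p i) (p (i + 1))) ∧
      InjOn p (Iic n) := by
  induction h using ReflTransGen.head_induction_on with
  | refl => exact ⟨0, fun _ => y, rfl, rfl, by simp, fun i hi j hj _ => by grind⟩
  | @head x z hxz _ ih =>
    obtain ⟨n, p, h0, hn, hp, hinj⟩ := ih
    by_cases hx : ∃ k ≤ n, p k = x
    · obtain ⟨k, hk, hkx⟩ := hx
      refine ⟨n - k, fun i => p (k + i), hkx, by grind, fun i hi => hp (k + i) (by lia), ?_⟩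
      intro i hi j hj hij
      have := hinj (show k + i ≤ n by grind) (show k + j ≤ n by grind) hij
      lia
    · push Not at hx
      refine ⟨n + 1, fun | 0 => x | i + 1 => p i, rfl, hn, ?_, ?_⟩
      · rintro (_ | i) hi
        · simpa only [h0] using hxz
        · exact hp i (by lia)
      · rintro (_ | i) hi (_ | j) hj hij
        · rfl
        · exact (hx j (Nat.le_of_succ_le_succ hj) hij.symm).elim
        · exact (hx i (Nat.le_of_succ_le_succ hi) hij).elim
        · exact congrArg Nat.succ (hinj (Nat.le_of_succ_le_succ hi) (Nat.le_of_succ_le_succ hj) hij)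

end Relations

theorem card_quotient_eq_card_maximal {X L : Type*} [Finite X] [LinearOrder L] {f : X → L}
    (hf : Function.Injective f) (s : Setoid X) :
    Nat.card (Quotient s) = Nat.card {x // ∀ y, s x y → f y ≤ f x} := by
  refine (Nat.card_congr (Equiv.ofBijective (fun x => Quotient.mk s x.1) ⟨?_, ?_⟩)).symm
  · rintro ⟨x, hx⟩ ⟨y, hy⟩ hxy
    have hxy : s x y := Quotient.exact hxy
    exact Subtype.ext (hf (le_antisymm (hy x (s.symm hxy)) (hx y hxy)))
  · rintro ⟨x⟩
    obtain ⟨y, hxy, hy⟩ := {y | s x y}.toFinite.exists_maximalFor f _ ⟨x, s.refl x⟩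
    refine ⟨⟨y, fun z hyz => ?_⟩, Quotient.sound (s.symm hxy)⟩
    exact (le_total (f z) (f y)).elim id (hy (s.trans hxy hyz))

namespace Graph.RefOrientation

variable {α β : Type*} {G : Graph α β} (o : G.RefOrientation)
  {A B A' B' : Set (V(G) × V(G))} {D D' D₀ : Set G.Arc} {X Y : Set E(G)} {e : E(G)} {b : Bool}

section Arcs

theorem src_not (e : E(G)) (b : Bool) : o.src (e, !b) = o.tgt (e, b) := by
  cases b <;> rfl

theorem tgt_not (e : E(G)) (b : Bool) : o.tgt (e, !b) = o.src (e, b) := by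
  cases b <;> rfl

theorem step_mono (hA : A ∪ B ⊆ A' ∪ B') (hD : D ⊆ D') : o.Step A B D ≤ o.Step A' B' D' :=
  fun _ _ => Or.imp (fun ⟨a, ha, h⟩ => ⟨a, hD ha, h⟩) (@hA _)

theorem step_insert_le (a : G.Arc) :
    o.Step A B (insert a D) ≤ o.Step A B D ⊔ singleArc (o.src a) (o.tgt a) := by
  rintro _ _ (⟨d, rfl | hd, rfl, rfl⟩ | h)
  · exact .inr ⟨rfl, rfl⟩
  · exact .inl (.inl ⟨d, hd, rfl, rfl⟩)
  · exact .inl (.inr h)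

theorem step_of_mem {a : G.Arc} (ha : a ∈ D) : o.Step A B D (o.src a) (o.tgt a) :=
  .inl ⟨a, ha, rfl, rfl⟩

/-- Adding the arc `a` to the digraph `R` creates no new closed walk through an arc of `R`. -/
def IsNeutral (R : V(G) → V(G) → Prop) (a : G.Arc) : Prop :=
  ReflTransGen R (o.tgt a) (o.src a) → ReflTransGen R (o.src a) (o.tgt a)

theorem reach_insert_iff_of_isNeutral (hD : D₀ ⊆ D) (hD' : D ⊆ insert (e, !b) D₀)
    (hb : o.IsNeutral (o.Step A B D₀) (e, b)) {x y : V(G)} (hxy : o.Step A B D₀ x y) :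
    ReflTransGen (o.Step A B (insert (e, b) D)) y x ↔ ReflTransGen (o.Step A B D) y x := by
  refine reflTransGen_iff_of_le_sup_singleArc (o.step_mono le_rfl hD) ?_
    (o.step_mono le_rfl (subset_insert _ D)) (o.step_insert_le (e, b)) hb hxy
  rw [← o.src_not e b, ← o.tgt_not e b]
  exact (o.step_mono le_rfl hD').trans (o.step_insert_le (e, !b))

theorem reach_insert_tgt_src_iff (a : G.Arc) :
    ReflTransGen (o.Step A B (insert a D)) (o.tgt a) (o.src a) ↔
      ReflTransGen (o.Step A B D) (o.tgt a) (o.src a) :=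
  ⟨fun h => reflTransGen_sup_singleArc_self.1 (ReflTransGen.mono (o.step_insert_le a) _ _ h),
    ReflTransGen.mono (o.step_mono le_rfl (subset_insert a D)) _ _⟩

theorem isValid_iff_of_reach_iff
    (h : ∀ u v, (u, v) ∈ A ∪ B →
      (ReflTransGen (o.Step A B D') v u ↔ ReflTransGen (o.Step A B D) v u)) :
    o.IsValid A B D' ↔ o.IsValid A B D :=
  and_congr
    (forall₃_congr fun u v huv => not_congr (h u v (.inl huv)))
    (forall₃_congr fun u v huv => h u v (.inr huv))

end Arcs

section Minors

/-- The arcs of the digraph obtained from `D` by deleting the edges in `X`. -/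
def deleteStep (X : Set E(G)) (D : Set G.Arc) : V(G) → V(G) → Prop :=
  o.Step ∅ ∅ {a ∈ D | a.1 ∉ X}

/-- The arcs of the digraph obtained from `D` by contracting the edges in `X` and the pairs in
`A ∪ B`: contracting is encoded as making both directions available. -/
def contractStep (A B : Set (V(G) × V(G))) (X : Set E(G)) (D : Set G.Arc) :
    V(G) → V(G) → Prop :=
  o.Step (A ∪ B) (Prod.swap ⁻¹' (A ∪ B)) (D ∪ {a | a.1 ∈ X})

theorem deleteStep_anti (h : Y ⊆ X) : o.deleteStep X D ≤ o.deleteStep Y D :=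
  o.step_mono le_rfl fun _ ha => ⟨ha.1, fun hY => ha.2 (h hY)⟩

theorem contractStep_mono (h : X ⊆ Y) : o.contractStep A B X D ≤ o.contractStep A B Y D :=
  o.step_mono le_rfl (union_subset_union_right D fun _ ha => h ha)

theorem deleteStep_le_step : o.deleteStep X D ≤ o.Step A B D :=
  o.step_mono (by simp) fun _ ha => ha.1

theorem step_le_contractStep : o.Step A B D ≤ o.contractStep A B X D :=
  o.step_mono subset_union_left subset_union_left

theorem deleteStep_insert (hX : e ∉ X) :
    o.deleteStep X (insert (e, b) D) = o.Step ∅ ∅ (insert (e, b) {a ∈ D | a.1 ∉ X}) := by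
  rw [deleteStep]
  congr 1
  grind

theorem deleteStep_insert_of_mem (hX : e ∈ X) :
    o.deleteStep X (insert (e, b) D) = o.deleteStep X D := by
  rw [deleteStep, deleteStep]
  congr 1
  grind

theorem contractStep_insert_of_mem (hX : e ∈ X) :
    o.contractStep A B X (insert (e, b) D) = o.contractStep A B X D := by
  rw [contractStep, contractStep]
  congr 1
  grind

variable [LinearOrder E(G)]

/-- Every edge `e` used by `D` against its conventional direction fails to close a directed cycle
of `D` whose least edge is `e`. -/
def IsCycleReduced (D : Set G.Arc) : Prop :=
  ∀ e, (e, false) ∈ D → ¬ ReflTransGen (o.deleteStep (Iic e) D) (o.tail e) (o.head e)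

/-- Every edge `e` not used by `D` in its conventional direction fails to be the least edge of an
`(A, B)`-cocycle of `D`: its head stays reachable from its tail after contracting the smaller
edges and `A ∪ B`. -/
def IsCocycleReduced (A B : Set (V(G) × V(G))) (D : Set G.Arc) : Prop :=
  ∀ e, (e, true) ∉ D → ReflTransGen (o.contractStep A B (Iio e) D) (o.tail e) (o.head e)

theorem reach_deleteStep_Iic_iff (h : (e, true) ∉ D) :
    ReflTransGen (o.deleteStep (Iic e) D) (o.tail e) (o.head e) ↔
      ReflTransGen (o.deleteStep (Iio e) D) (o.tail e) (o.head e) := by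
  refine ⟨ReflTransGen.mono (o.deleteStep_anti Iio_subset_Iic_self) _ _, fun hr => ?_⟩
  refine (o.reach_insert_tgt_src_iff (e, false)).1
    (ReflTransGen.mono (o.step_mono le_rfl ?_) _ _ hr)
  rintro ⟨j, _ | _⟩ ⟨hj, hje⟩ <;> grind

end Minors

section NeutralDirection

variable [LinearOrder E(G)]

/-- Adding `(e, b)` to `D₀`, possibly after `(e, !b)`, affects neither validity nor reducedness. -/
structure IsNeutralDirection (A B : Set (V(G) × V(G))) (D₀ : Set G.Arc) (e : E(G)) (b : Bool) :
    Prop where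
  isNeutral_step : o.IsNeutral (o.Step A B D₀) (e, b)
  isNeutral_deleteStep : ∀ j < e, o.IsNeutral (o.deleteStep (Iio j) D₀) (e, b)
  isNeutral_contractStep : ∀ j < e, o.IsNeutral (o.contractStep A B (Iio j) D₀) (e, b)
  not_reach : b = false → ¬ ReflTransGen (o.deleteStep (Iio e) D₀) (o.tail e) (o.head e)
  reach : b = true → ReflTransGen (o.contractStep A B (Iio e) D₀) (o.tail e) (o.head e)

theorem isChain_minors (A B : Set (V(G) × V(G))) (D : Set G.Arc) :
    IsChain (· ≤ ·) (insert (o.Step A B D) (range (fun j => o.deleteStep (Iio j) D) ∪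
      range fun j => o.contractStep A B (Iio j) D)) := by
  have hdel : ∀ j, o.deleteStep (Iio j) D ≤ o.Step A B D := fun j => o.deleteStep_le_step
  have hcon : ∀ j, o.Step A B D ≤ o.contractStep A B (Iio j) D := fun j => o.step_le_contractStep
  rintro _ (rfl | ⟨i, rfl⟩ | ⟨i, rfl⟩) _ (rfl | ⟨j, rfl⟩ | ⟨j, rfl⟩) -
  · exact .inl le_rfl
  · exact .inr (hdel j)
  · exact .inl (hcon j)
  · exact .inl (hdel i)
  · exact (le_total j i).imp (fun h => o.deleteStep_anti (Iio_subset_Iio h))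
      fun h => o.deleteStep_anti (Iio_subset_Iio h)
  · exact .inl ((hdel i).trans (hcon j))
  · exact .inr (hcon i)
  · exact .inr ((hdel j).trans (hcon i))
  · exact (le_total i j).imp (fun h => o.contractStep_mono (Iio_subset_Iio h))
      fun h => o.contractStep_mono (Iio_subset_Iio h)

theorem exists_isNeutralDirection (A B : Set (V(G) × V(G))) (D₀ : Set G.Arc) (e : E(G)) :
    ∃ b, o.IsNeutralDirection A B D₀ e b := by
  have hcon : ∀ j < e, o.contractStep A B (Iio j) D₀ ≤ o.contractStep A B (Iio e) D₀ :=
    fun j hj => o.contractStep_mono (Iio_subset_Iio hj.le)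
  have hdel : ∀ j < e, o.deleteStep (Iio e) D₀ ≤ o.deleteStep (Iio j) D₀ :=
    fun j hj => o.deleteStep_anti (Iio_subset_Iio hj.le)
  by_cases hc : ReflTransGen (o.contractStep A B (Iio e) D₀) (o.tail e) (o.head e)
  swap
  · have hbot {R : V(G) → V(G) → Prop} (hR : R ≤ o.contractStep A B (Iio e) D₀) :
        o.IsNeutral R (e, false) := fun h => (hc (ReflTransGen.mono hR _ _ h)).elim
    exact ⟨false, hbot o.step_le_contractStep,
      fun _ _ => hbot (o.deleteStep_le_step.trans o.step_le_contractStep),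
      fun j hj => hbot (hcon j hj),
      fun _ h => hc (ReflTransGen.mono (o.deleteStep_le_step.trans o.step_le_contractStep) _ _ h),
      fun h => by contradiction⟩
  by_cases hd : ReflTransGen (o.deleteStep (Iio e) D₀) (o.tail e) (o.head e)
  · have htop {R : V(G) → V(G) → Prop} (hR : o.deleteStep (Iio e) D₀ ≤ R) :
        o.IsNeutral R (e, true) := fun _ => ReflTransGen.mono hR _ _ hd
    exact ⟨true, htop o.deleteStep_le_step, fun j hj => htop (hdel j hj),
      fun _ _ => htop (o.deleteStep_le_step.trans o.step_le_contractStep),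
      fun h => by contradiction, fun _ => hc⟩
  rcases forall_reflTransGen_imp_or_of_isChain (o.isChain_minors A B D₀) (o.tail e) (o.head e)
    with h | h
  · exact ⟨false, h _ (.inl rfl), fun j _ => h _ (.inr (.inl ⟨j, rfl⟩)),
      fun j _ => h _ (.inr (.inr ⟨j, rfl⟩)), fun _ => hd, fun _ => hc⟩
  · exact ⟨true, h _ (.inl rfl), fun j _ => h _ (.inr (.inl ⟨j, rfl⟩)),
      fun j _ => h _ (.inr (.inr ⟨j, rfl⟩)), fun _ => hd, fun _ => hc⟩

/-- Every edge below `e` carries exactly one arc of `D`. -/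
def IsOrientedBelow (e : E(G)) (D : Set G.Arc) : Prop :=
  ∀ j < e, ((j, false) ∈ D ↔ (j, true) ∉ D)

variable {o} (hb : o.IsNeutralDirection A B D₀ e b) (hor : IsOrientedBelow e D₀)
  (hD : D₀ ⊆ D) (hD' : D ⊆ insert (e, !b) D₀)

include hb hD hD'

namespace IsNeutralDirection

theorem isValid_insert_iff : o.IsValid A B (insert (e, b) D) ↔ o.IsValid A B D :=
  o.isValid_iff_of_reach_iff fun _ _ huv =>
    o.reach_insert_iff_of_isNeutral hD hD' hb.isNeutral_step (.inr huv)

include hor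

theorem isCycleReduced_insert_iff : o.IsCycleReduced (insert (e, b) D) ↔ o.IsCycleReduced D := by
  refine forall_congr' fun j => ?_
  rcases lt_trichotomy j e with hj | rfl | hj
  · have hmem (c : Bool) : (j, c) ∈ insert (e, b) D ↔ (j, c) ∈ D := by grind
    rw [hmem]
    refine imp_congr_right fun hjD => not_congr ?_
    have hjD₀ : (j, false) ∈ {a ∈ D₀ | a.1 ∉ Iio j} := by grind
    have hjt : (j, true) ∉ D := by grind [hor j hj]
    rw [o.reach_deleteStep_Iic_iff hjt, o.reach_deleteStep_Iic_iff (by rwa [hmem]),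
      o.deleteStep_insert (notMem_Iio.2 hj.le)]
    exact o.reach_insert_iff_of_isNeutral (by grind) (by grind) (hb.isNeutral_deleteStep j hj)
      (o.step_of_mem hjD₀)
  · rw [o.deleteStep_insert_of_mem self_mem_Iic]
    cases b
    · have hle : o.deleteStep (Iic j) D ≤ o.deleteStep (Iio j) D₀ :=
        o.step_mono le_rfl (by grind)
      have := mt (ReflTransGen.mono hle _ _) (hb.not_reach rfl)
      exact iff_of_true (fun _ => this) (fun _ => this)
    · simp
  · rw [o.deleteStep_insert_of_mem (mem_Iic.2 hj.le), mem_insert_iff,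
      or_iff_right (by simp [hj.ne'])]

theorem isCocycleReduced_insert_iff :
    o.IsCocycleReduced A B (insert (e, b) D) ↔ o.IsCocycleReduced A B D := by
  refine forall_congr' fun j => ?_
  rcases lt_trichotomy j e with hj | rfl | hj
  · have hmem : (j, true) ∈ insert (e, b) D ↔ (j, true) ∈ D := by grind
    rw [hmem]
    refine imp_congr_right fun hjD => ?_
    have hjD₀ : (j, false) ∈ D₀ ∪ {a | a.1 ∈ Iio j} := by grind [hor j hj]
    rw [contractStep, insert_union]
    exact o.reach_insert_iff_of_isNeutral (by grind) (by grind) (hb.isNeutral_contractStep j hj)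
      (o.step_of_mem hjD₀)
  · cases b
    · rw [contractStep, insert_union]
      exact imp_congr (by simp) (o.reach_insert_tgt_src_iff (j, false))
    · have hle : o.contractStep A B (Iio j) D₀ ≤ o.contractStep A B (Iio j) D :=
        o.step_mono le_rfl (union_subset_union_left _ hD)
      exact iff_of_true (fun h => (h (mem_insert _ _)).elim)
        fun _ => ReflTransGen.mono hle _ _ (hb.reach rfl)
  · rw [o.contractStep_insert_of_mem (mem_Iio.2 hj), mem_insert_iff,
      or_iff_right (by simp [hj.ne'])]

end IsNeutralDirection

end NeutralDirection

section Bijection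

variable {γ : Type*} {f : Set G.Arc → γ} {L : Set E(G)} {ω : G.Orientation}

/-- The arcs of the digraph read off from `ω` by treating it as an orientation on `L` and as the
indicator of a subgraph outside `L`; it interpolates between subgraphs and orientations. -/
def mixedArcs (L : Set E(G)) (ω : G.Orientation) : Set G.Arc :=
  {a | (a.1 ∈ L → ω a.1 = a.2) ∧ (a.1 ∉ L → ω a.1 = true)}

theorem mixedArcs_univ (ω : G.Orientation) : mixedArcs univ ω = orientationArcs ω := by
  simp [mixedArcs, orientationArcs]

theorem mixedArcs_empty (ω : G.Orientation) : mixedArcs ∅ ω = subgraphArcs {e | ω e = true} := by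
  simp [mixedArcs, subgraphArcs]

variable [LinearOrder E(G)]

theorem isOrientedBelow_mixedArcs (e : E(G)) (ω : G.Orientation) :
    IsOrientedBelow e (mixedArcs (Iio e) ω) := fun j hj => by
  simp [mixedArcs, hj]

theorem mixedArcs_Iic_update (e : E(G)) (b : Bool) (ω : G.Orientation) :
    mixedArcs (Iic e) (Function.update ω e b) =
      insert (e, b) (mixedArcs (Iio e) (Function.update ω e false)) := by
  ext ⟨j, c⟩
  rcases eq_or_ne j e with rfl | hj
  · cases b <;> cases c <;> simp [mixedArcs]
  · simp [mixedArcs, hj, le_iff_lt_or_eq]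

theorem mixedArcs_Iio_eq_insert (b : Bool) (h : ω e = true) :
    mixedArcs (Iio e) ω = insert (e, b) (mixedArcs (Iic e) (Function.update ω e !b)) := by
  ext ⟨j, c⟩
  rcases eq_or_ne j e with rfl | hj
  · cases b <;> cases c <;> simp [mixedArcs, h]
  · simp [mixedArcs, hj, le_iff_lt_or_eq]

theorem exists_perm_mixedArcs_Iic_eq (e : E(G))
    (hf : ∀ D₀, IsOrientedBelow e D₀ →
      ∃ b, ∀ D, D₀ ⊆ D → D ⊆ insert (e, !b) D₀ → f (insert (e, b) D) = f D) :
    ∃ σ : Equiv.Perm G.Orientation, ∀ ω, f (mixedArcs (Iic e) (σ ω)) = f (mixedArcs (Iio e) ω) := by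
  choose b hb using fun ω => hf _ (isOrientedBelow_mixedArcs e ω)
  let σ (ω : G.Orientation) : G.Orientation :=
    Function.update ω e (ω e ^^ b (Function.update ω e false))
  have hσ : Function.Involutive σ := fun ω => by simp [σ]
  refine ⟨hσ.toPerm, fun ω => ?_⟩
  have hb := hb (Function.update ω e false)
  rw [hσ.coe_toPerm]
  simp only [σ]
  cases h : ω e
  · rw [mixedArcs_Iic_update, Bool.false_xor, hb _ le_rfl (subset_insert _ _),
      Function.update_eq_self_iff.2 h.symm]
  · rw [Bool.true_xor, mixedArcs_Iio_eq_insert _ h, mixedArcs_Iic_update,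
      hb _ (subset_insert _ _) le_rfl]

theorem exists_perm_mixedArcs_eq [Finite E(G)]
    (hf : ∀ e D₀, IsOrientedBelow e D₀ →
      ∃ b, ∀ D, D₀ ⊆ D → D ⊆ insert (e, !b) D₀ → f (insert (e, b) D) = f D)
    (hL : IsLowerSet L) :
    ∃ σ : Equiv.Perm G.Orientation, ∀ ω, f (mixedArcs L (σ ω)) = f (mixedArcs ∅ ω) := by
  lift L to Finset E(G) using L.toFinite
  induction L using Finset.induction_on_max with
  | empty => exact ⟨1, fun ω => by simp⟩
  | insert e S hS ih =>
    have hSe : (S : Set E(G)) = Iio e := by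
      ext j
      refine ⟨hS j, fun hj => ?_⟩
      exact (Finset.mem_insert.1 (hL hj.le (Finset.mem_insert_self e S))).resolve_left hj.ne
    obtain ⟨σ, hσ⟩ := ih (hSe ▸ isLowerSet_Iio e)
    obtain ⟨τ, hτ⟩ := exists_perm_mixedArcs_Iic_eq e (hf e)
    refine ⟨σ.trans τ, fun ω => ?_⟩
    rw [Finset.coe_insert, hSe, Iio_insert, Equiv.trans_apply, hτ, ← hSe, hσ]

theorem exists_equiv_subgraphArcs_eq [Finite E(G)]
    (hf : ∀ e D₀, IsOrientedBelow e D₀ →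
      ∃ b, ∀ D, D₀ ⊆ D → D ⊆ insert (e, !b) D₀ → f (insert (e, b) D) = f D) :
    ∃ φ : Set E(G) ≃ G.Orientation, ∀ F, f (orientationArcs (φ F)) = f (subgraphArcs F) := by
  classical
  obtain ⟨σ, hσ⟩ := exists_perm_mixedArcs_eq hf isLowerSet_univ
  let χ : Set E(G) ≃ G.Orientation :=
    { toFun := fun F e => decide (e ∈ F)
      invFun := fun ω => {e | ω e = true}
      left_inv := fun F => by simp
      right_inv := fun ω => by simp }
  refine ⟨χ.trans σ, fun F => ?_⟩
  rw [← mixedArcs_univ, Equiv.trans_apply, hσ, mixedArcs_empty]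
  simp [χ]

variable (A B)

theorem exists_equiv_reduced_iff [Finite E(G)] :
    ∃ φ : Set E(G) ≃ G.Orientation, ∀ F,
      (o.IsValid A B (orientationArcs (φ F)) ↔ o.IsValid A B (subgraphArcs F)) ∧
      (o.IsCycleReduced (orientationArcs (φ F)) ↔ o.IsCycleReduced (subgraphArcs F)) ∧
      (o.IsCocycleReduced A B (orientationArcs (φ F)) ↔
        o.IsCocycleReduced A B (subgraphArcs F)) := by
  let f (D : Set G.Arc) := (o.IsValid A B D, o.IsCycleReduced D, o.IsCocycleReduced A B D)
  obtain ⟨φ, hφ⟩ := exists_equiv_subgraphArcs_eq (f := f) fun e D₀ hor => by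
    obtain ⟨b, hb⟩ := o.exists_isNeutralDirection A B D₀ e
    refine ⟨b, fun D hD hD' => ?_⟩
    rw [Prod.mk.injEq, Prod.mk.injEq]
    exact ⟨propext (hb.isValid_insert_iff hD hD'),
      propext (hb.isCycleReduced_insert_iff hor hD hD'),
      propext (hb.isCocycleReduced_insert_iff hor hD hD')⟩
  refine ⟨φ, fun F => ?_⟩
  simpa only [f, Prod.mk.injEq, eq_iff_iff] using hφ F

end Bijection

section Cycles

variable {n : ℕ} {c : Fin (n + 1) → G.Arc} {a : G.Arc}

theorem isCycle_of_injective_src (hc : ∀ i, o.tgt (c i) = o.src (c (i + 1)))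
    (hinj : Function.Injective fun i => o.src (c i))
    (hlast : ∀ i, (c i).1 = (c (Fin.last n)).1 → i = Fin.last n) : o.IsCycle c := by
  refine ⟨hc, hinj, fun i j hij => ?_⟩
  have hij : (c i).1 = (c j).1 := hij
  by_contra hne
  have hi : i ≠ Fin.last n := by grind
  have hj : j ≠ Fin.last n := by grind
  have hopp : c i = ((c j).1, !(c j).2) := by
    refine Prod.ext hij (Bool.eq_not_of_ne fun hdir => hne (hinj ?_))
    exact congrArg o.src (Prod.ext hij hdir)
  have hi' : i = j + 1 := hinj (by simp only [hopp, o.src_not, ← hc])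
  have hj' : j = i + 1 := hinj (by simp only [← hc, hopp, o.tgt_not])
  have hiv := congrArg Fin.val hi'
  have hjv := congrArg Fin.val hj'
  rw [Fin.val_add_one_of_lt (Fin.lt_last_iff_ne_last.2 hj)] at hiv
  rw [Fin.val_add_one_of_lt (Fin.lt_last_iff_ne_last.2 hi)] at hjv
  lia

theorem exists_isCycle_of_reach (hD : ∀ d ∈ D, d.1 ≠ a.1)
    (h : ReflTransGen (o.Step ∅ ∅ D) (o.tgt a) (o.src a)) :
    ∃ (n : ℕ) (c : Fin (n + 1) → G.Arc),
      o.IsCycle c ∧ c (Fin.last n) = a ∧ ∀ i, c i ∈ insert a D := by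
  obtain ⟨n, p, h0, hn, hp, hinj⟩ := exists_injOn_walk h
  have hstep (i : Fin n) : ∃ d ∈ D, o.src d = p i ∧ o.tgt d = p (i + 1) :=
    (hp i i.2).elim id (·.elim False.elim False.elim)
  choose d hdD hsrc htgt using hstep
  let c : Fin (n + 1) → G.Arc := Fin.snoc d a
  have hlast : c (Fin.last n) = a := Fin.snoc_last _ _
  have hcast (i : Fin n) : c i.castSucc = d i := Fin.snoc_castSucc _ _ _
  have hsrcc (i : Fin (n + 1)) : o.src (c i) = p i := by
    cases i using Fin.lastCases with
    | last => rw [hlast, Fin.val_last, hn]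
    | cast i => rw [hcast, hsrc, Fin.val_castSucc]
  refine ⟨n, c, o.isCycle_of_injective_src (fun i => ?_) (fun i j hij => ?_) (fun i hi => ?_),
    hlast, fun i => ?_⟩
  · rw [hsrcc]
    cases i using Fin.lastCases with
    | last => rw [hlast, Fin.last_add_one, Fin.val_zero, h0]
    | cast i => rw [hcast, htgt, Fin.coeSucc_eq_succ, Fin.val_succ]
  · simp only [hsrcc] at hij
    exact Fin.ext (hinj (mem_Iic.2 i.is_le) (mem_Iic.2 j.is_le) hij)
  · cases i using Fin.lastCases with
    | last => rfl
    | cast i => exact (hD _ (hdD i) (by rwa [hcast, hlast] at hi)).elim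
  · cases i using Fin.lastCases with
    | last => exact .inl hlast
    | cast i => exact .inr (hcast i ▸ hdD i)

variable {o} in
theorem IsCycle.reach (hc : o.IsCycle c) (i : Fin (n + 1)) :
    ReflTransGen (o.Step A B {a | ∃ j ≠ i, c j = a}) (o.tgt (c i)) (o.src (c i)) := by
  by_contra hi
  have key (t : ℕ) : ReflTransGen (o.Step A B {a | ∃ j ≠ i, c j = a}) (o.tgt (c i))
      (o.src (c (i + 1 + t • 1))) := by
    induction t with
    | zero => rw [hc.1 i, zero_nsmul, add_zero]
    | succ t ih =>
      refine ih.tail (.inl ⟨_, ⟨i + 1 + t • 1, fun h => hi (by rwa [h] at ih), rfl⟩, rfl, ?_⟩)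
      rw [hc.1, succ_nsmul, add_assoc]
  have hcard : (n + 1) • (1 : Fin (n + 1)) = 0 := by
    simpa using card_nsmul_eq_zero (x := (1 : Fin (n + 1)))
  refine hi ?_
  simpa only [add_assoc, ← succ_nsmul', hcard, add_zero] using key n

end Cycles

section Subgraphs

variable {F : Set E(G)} {C : Set (V(G) × V(G))}

theorem adjAdd_eq_step (A B : Set (V(G) × V(G))) (F : Set E(G)) :
    AdjAdd A B F = o.Step (A ∪ B) (Prod.swap ⁻¹' (A ∪ B)) (subgraphArcs F) := by
  ext u v
  refine or_congr ⟨?_, ?_⟩ Iff.rfl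
  · rintro ⟨e, he, h⟩
    rcases h.eq_and_eq_or_eq_and_eq (o.isLink e) with ⟨hu, hv⟩ | ⟨hu, hv⟩
    · exact ⟨(e, true), he, Subtype.ext hu.symm, Subtype.ext hv.symm⟩
    · exact ⟨(e, false), he, Subtype.ext hu.symm, Subtype.ext hv.symm⟩
  · rintro ⟨⟨e, _ | _⟩, he, rfl, rfl⟩
    · exact ⟨e, he, (o.isLink e).symm⟩
    · exact ⟨e, he, o.isLink e⟩

instance symm_step : Std.Symm (o.Step C (Prod.swap ⁻¹' C) (subgraphArcs F)) where
  symm := by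
    rintro _ _ (⟨⟨e, b⟩, he, rfl, rfl⟩ | h | h)
    · exact .inl ⟨(e, !b), he, o.src_not e b, o.tgt_not e b⟩
    · exact .inr (.inr h)
    · exact .inr (.inl h)

theorem deleteStep_subgraphArcs (X F : Set E(G)) :
    o.deleteStep X (subgraphArcs F) = o.Step ∅ (Prod.swap ⁻¹' ∅) (subgraphArcs (F \ X)) := rfl

theorem contractStep_subgraphArcs (X F : Set E(G)) :
    o.contractStep A B X (subgraphArcs F) =
      o.Step (A ∪ B) (Prod.swap ⁻¹' (A ∪ B)) (subgraphArcs (F ∪ X)) := rfl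

theorem contractStep_subgraphArcs_le
    (h : ∀ e ∈ X, ReflTransGen (o.contractStep A B ∅ (subgraphArcs F)) (o.tail e) (o.head e)) :
    o.contractStep A B X (subgraphArcs F) ≤
      ReflTransGen (o.contractStep A B ∅ (subgraphArcs F)) := by
  simp only [contractStep_subgraphArcs, union_empty] at h ⊢
  rintro _ _ (⟨⟨e, b⟩, he | he, rfl, rfl⟩ | hAB)
  · exact .single (o.step_of_mem he)
  · cases b
    · exact symm_of (ReflTransGen _) (h e he)
    · exact h e he
  · exact .single (.inr hAB)

variable [LinearOrder E(G)]

theorem isForest_iff_isCycleReduced : o.IsForest F ↔ o.IsCycleReduced (subgraphArcs F) := by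
  constructor
  · intro hF e he hreach
    obtain ⟨n, c, hc, -, hcD⟩ := o.exists_isCycle_of_reach (a := (e, false)) (by grind) hreach
    exact hF ⟨n, c, hc, fun i => (hcD i).elim (fun h => h ▸ he) fun h => h.1⟩
  · rintro h ⟨n, c, hc, hcF⟩
    obtain ⟨i, hi⟩ := Finite.exists_min fun i => (c i).1
    have hreach : ReflTransGen (o.deleteStep (Iic (c i).1) (subgraphArcs F))
        (o.tgt (c i)) (o.src (c i)) := by
      refine ReflTransGen.mono (o.step_mono le_rfl ?_) _ _ (hc.reach i)
      rintro _ ⟨j, hj, rfl⟩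
      exact ⟨hcF j, fun hle => hj (hc.2.2 (le_antisymm hle (hi j)))⟩
    refine h (c i).1 (hcF i) ?_
    rw [deleteStep_subgraphArcs] at hreach ⊢
    cases hb : (c i).2
    · simpa [src, tgt, hb] using hreach
    · refine symm_of (ReflTransGen _) ?_
      simpa [src, tgt, hb] using hreach

theorem isABConnected_iff_isCocycleReduced [WellFoundedLT E(G)] :
    IsABConnected A B F ↔ o.IsCocycleReduced A B (subgraphArcs F) := by
  simp only [IsABConnected, o.adjAdd_eq_step]
  constructor
  · intro h e _
    refine ReflTransGen.mono (o.step_mono le_rfl subset_union_left) _ _ ((h _ _).2 ?_)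
    exact .single (o.step_of_mem (a := (e, true)) (mem_univ e))
  · intro h u v
    refine ⟨ReflTransGen.mono (o.step_mono le_rfl fun a _ => mem_univ a.1) u v, ?_⟩
    have hedge (e : E(G)) :
        ReflTransGen (o.contractStep A B ∅ (subgraphArcs F)) (o.tail e) (o.head e) := by
      induction e using WellFoundedLT.induction with
      | ind e ih =>
        by_cases he : e ∈ F
        · exact .single (o.step_of_mem (a := (e, true)) (.inl he))
        · exact reflTransGen_closed (o.contractStep_subgraphArcs_le ih) _ _ (h e he)
    have huniv := reflTransGen_closed
      (o.contractStep_subgraphArcs_le fun e (_ : e ∈ univ) => hedge e)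
    simp only [contractStep_subgraphArcs, union_univ, union_empty] at huniv
    exact huniv u v

end Subgraphs

section Reversals

variable {ω ω' : G.Orientation} {a : G.Arc}

theorem exists_mem_orientationArcs_iff {P : G.Arc → Prop} :
    (∃ a ∈ orientationArcs ω, a.1 = e ∧ P a) ↔ P (e, ω e) := by
  constructor
  · rintro ⟨⟨e, b⟩, hb, rfl, h⟩
    obtain rfl : ω e = b := hb
    exact h
  · exact fun h => ⟨(e, ω e), rfl, rfl, h⟩

theorem mem_orientationArcs_reverse_of_mem (ha : a.1 ∈ X) :
    a ∈ orientationArcs (reverse ω X) ↔ (a.1, !a.2) ∈ orientationArcs ω := by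
  simp [orientationArcs, reverse, ha, Bool.not_eq_eq_eq_not]

theorem mem_orientationArcs_reverse_of_notMem (ha : a.1 ∉ X) :
    a ∈ orientationArcs (reverse ω X) ↔ a ∈ orientationArcs ω := by
  simp [orientationArcs, reverse, ha]

variable {o}

theorem CycleReversal.reach_le (h : o.CycleReversal ω ω') :
    ReflTransGen (o.Step A B (orientationArcs ω')) ≤
      ReflTransGen (o.Step A B (orientationArcs ω)) := by
  obtain ⟨X, ⟨n, c, hc, hω, rfl⟩, rfl⟩ := h
  refine reflTransGen_closed ?_
  rintro _ _ (⟨⟨e, b⟩, ha, rfl, rfl⟩ | hAB)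
  · by_cases he : e ∈ range fun i => (c i).1
    · rw [mem_orientationArcs_reverse_of_mem he] at ha
      obtain ⟨i, rfl⟩ := he
      have hi : c i = ((c i).1, !b) := Prod.ext rfl ((hω i).symm.trans ha)
      have hle : o.Step A B {a | ∃ j ≠ i, c j = a} ≤ o.Step A B (orientationArcs ω) :=
        o.step_mono le_rfl (by rintro _ ⟨j, -, rfl⟩; exact hω j)
      have hreach := ReflTransGen.mono hle _ _ (hc.reach i)
      rwa [hi, o.src_not, o.tgt_not] at hreach
    · exact .single (o.step_of_mem ((mem_orientationArcs_reverse_of_notMem he).1 ha))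
  · exact .single (.inr hAB)

theorem CycleReversal.isValid_iff (h : o.CycleReversal ω ω') :
    o.IsValid A B (orientationArcs ω') ↔ o.IsValid A B (orientationArcs ω) :=
  o.isValid_iff_of_reach_iff fun u v _ =>
    ⟨h.reach_le v u, (o.cycleReversal_symm h).reach_le v u⟩

theorem CocycleReversal.reach (h : o.CocycleReversal A B ω ω') {u v : V(G)}
    (huv : (u, v) ∈ A ∪ B) (hvu : ReflTransGen (o.Step A B (orientationArcs ω)) v u) :
    ReflTransGen (o.Step A B (orientationArcs ω')) v u := by
  obtain ⟨X, ⟨-, U, rfl, hU, hABU, -⟩, rfl⟩ := h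
  have hback (x y : V(G)) (hxy : o.Step A B (orientationArcs ω) x y) (hy : y ∈ U) : x ∈ U := by
    rcases hxy with ⟨a, ha, rfl, rfl⟩ | hAB
    · exact by_contra fun hx => hU a ha ⟨hx, hy⟩
    · exact by_contra fun hx => hABU (x, y) hAB ⟨hx, hy⟩
  have hvuU : v ∈ U → u ∈ U := fun hv => by_contra fun hu => hABU (u, v) huv ⟨hu, hv⟩
  refine ReflTransGen.mono ?_ _ _ (reflTransGen_restrict hback hvu hvuU)
  rintro _ _ ⟨⟨a, ha, rfl, rfl⟩ | hAB, hside⟩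
  · refine .inl ⟨a, (mem_orientationArcs_reverse_of_notMem ?_).2 ha, rfl, rfl⟩
    rintro ⟨⟨_, _⟩, hb, rfl, hs, ht⟩
    obtain rfl := hb.symm.trans ha
    exact ht (hside.1 hs)
  · exact .inr hAB

theorem CocycleReversal.isValid_iff (h : o.CocycleReversal A B ω ω') :
    o.IsValid A B (orientationArcs ω') ↔ o.IsValid A B (orientationArcs ω) :=
  o.isValid_iff_of_reach_iff fun _ _ huv =>
    ⟨(o.cocycleReversal_symm A B h).reach huv, h.reach huv⟩

end Reversals

section MaximalIsReduced

variable {ω : G.Orientation} [LinearOrder E(G)]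

theorem toLex_lt_toLex_reverse (he : IsLeast X e) (hω : ω e = false) :
    toLex ω < toLex (reverse ω X) := by
  refine ⟨e, fun j hj => (if_neg fun hjX => ?_).symm, ?_⟩
  · exact (he.2 hjX).not_gt hj
  · simp [reverse, he.1, hω]

theorem isCycleReduced_of_forall_le
    (h : ∀ ω', o.CycleReversal ω ω' → toLex ω' ≤ toLex ω) :
    o.IsCycleReduced (orientationArcs ω) := by
  intro e he hreach
  obtain ⟨n, c, hc, hlast, hcD⟩ := o.exists_isCycle_of_reach (a := (e, false)) (by grind) hreach
  have hω (i) : c i ∈ orientationArcs ω := (hcD i).elim (fun h => h ▸ he) fun h => h.1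
  have hleast : IsLeast (range fun i => (c i).1) e := by
    refine ⟨⟨Fin.last n, congrArg Prod.fst hlast⟩, ?_⟩
    rintro _ ⟨i, rfl⟩
    exact (hcD i).elim (fun h => (congrArg Prod.fst h).ge) fun h => (not_le.1 h.2).le
  exact (h _ ⟨_, ⟨n, c, hc, hω, rfl⟩, rfl⟩).not_gt (toLex_lt_toLex_reverse hleast he)

theorem isCocycleReduced_of_forall_le
    (h : ∀ ω', o.CocycleReversal A B ω ω' → toLex ω' ≤ toLex ω) :
    o.IsCocycleReduced A B (orientationArcs ω) := by
  intro e he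
  by_contra hreach
  have hωe : ω e = false := by simpa [orientationArcs] using he
  let U : Set V(G) := {x | ¬ ReflTransGen (o.contractStep A B (Iio e) (orientationArcs ω))
    (o.tail e) x}
  have hstep {x y} (hxy : o.contractStep A B (Iio e) (orientationArcs ω) x y) (hy : y ∈ U) :
      x ∈ U := fun hx => hy (hx.tail hxy)
  have htail : o.tail e ∉ U := fun h => h .refl
  let X : Set E(G) := {j | ∃ a ∈ orientationArcs ω, a.1 = j ∧ o.src a ∈ U ∧ o.tgt a ∉ U}
  have hleast : IsLeast X e := by
    refine ⟨⟨(e, false), hωe, rfl, hreach, htail⟩, ?_⟩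
    rintro _ ⟨⟨j, b⟩, -, rfl, hs, ht⟩
    refine not_lt.1 fun hj => ht (hstep ?_ hs)
    rw [← o.src_not j b, ← o.tgt_not j b]
    have hmem : (j, !b) ∈ orientationArcs ω ∪ {a | a.1 ∈ Iio e} := .inr hj
    exact o.step_of_mem hmem
  refine (h _ ⟨X, ⟨⟨e, hleast.1⟩, U, rfl, ?_, ?_, ?_⟩, rfl⟩).not_gt
    (toLex_lt_toLex_reverse hleast hωe)
  · exact fun a ha ⟨hs, ht⟩ => hs (hstep (o.step_of_mem (.inl ha)) ht)
  · exact fun p hp ⟨hs, ht⟩ => hs (hstep (.inr (.inl hp)) ht)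
  · exact fun p hp ⟨hs, ht⟩ => ht (hstep (.inr (.inr hp)) hs)

end MaximalIsReduced

section FlowsAndTensions

open scoped Matrix

variable {ω ω' : G.Orientation}

/-- The difference of two orientations as an integral edge vector: `1` on the edges which only `ω'`
directs conventionally and `-1` on those which only `ω` does. -/
def diff (ω ω' : G.Orientation) (e : E(G)) : ℤ := (ω' e).toInt - (ω e).toInt

/-- The coboundary of an integral potential: its increase along each edge in the conventional
direction. -/
def coboundary : (V(G) → ℤ) →+ (E(G) → ℤ) :=
  AddMonoidHom.mk' (fun p e => p (o.head e) - p (o.tail e)) fun p q => by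
    ext e
    exact add_sub_add_comm _ _ _ _

theorem coboundary_apply (p : V(G) → ℤ) (e : E(G)) :
    o.coboundary p e = p (o.head e) - p (o.tail e) := rfl

/-- The integral tensions of `G` that vanish along the pairs in `A ∪ B`, i.e. the coboundaries of
the potentials that are constant along these pairs. -/
def tensions (A B : Set (V(G) × V(G))) : AddSubgroup (E(G) → ℤ) where
  carrier := {t | ∃ p : V(G) → ℤ, (∀ x ∈ A ∪ B, p x.1 = p x.2) ∧ o.coboundary p = t}
  zero_mem' := ⟨0, fun _ _ => rfl, map_zero _⟩
  add_mem' := by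
    rintro _ _ ⟨p, hp, rfl⟩ ⟨q, hq, rfl⟩
    exact ⟨p + q, fun x hx => congrArg₂ (· + ·) (hp x hx) (hq x hx), map_add _ p q⟩
  neg_mem' := by
    rintro _ ⟨p, hp, rfl⟩
    exact ⟨-p, fun x hx => congrArg (- ·) (hp x hx), map_neg _ p⟩

/-- The integral flows of `G`, encoded as the edge vectors orthogonal to every coboundary. -/
def flows [Fintype E(G)] : AddSubgroup (E(G) → ℤ) where
  carrier := {z | ∀ q : V(G) → ℤ, z ⬝ᵥ o.coboundary q = 0}
  zero_mem' _ := zero_dotProduct _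
  add_mem' hz hz' q := by rw [add_dotProduct, hz q, hz' q, add_zero]
  neg_mem' hz q := by rw [neg_dotProduct, hz q, neg_zero]

theorem diff_mem_of_reflTransGen {r : G.Orientation → G.Orientation → Prop}
    {H : AddSubgroup (E(G) → ℤ)} (hr : ∀ {ω ω'}, r ω ω' → diff ω ω' ∈ H)
    (h : ReflTransGen r ω ω') : diff ω ω' ∈ H := by
  induction h with
  | refl => exact (funext fun e => sub_self _ : diff ω ω = 0) ▸ H.zero_mem
  | @tail ω₁ ω₂ _ h₁₂ ih =>
    have hadd : diff ω ω₁ + diff ω₁ ω₂ = diff ω ω₂ := funext fun e => sub_add_sub_cancel' _ _ _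
    exact hadd ▸ H.add_mem ih (hr h₁₂)

theorem diff_reverse_of_notMem (he : e ∉ X) : diff ω (reverse ω X) e = 0 := by
  simp [diff, reverse, he]

theorem diff_reverse_mul_coboundary (he : e ∈ X) (q : V(G) → ℤ) :
    diff ω (reverse ω X) e * o.coboundary q e = q (o.src (e, ω e)) - q (o.tgt (e, ω e)) := by
  cases h : ω e <;> simp [diff, reverse, he, h, coboundary_apply, src, tgt]

variable {o}

theorem CycleReversal.diff_mem_flows [Fintype E(G)] (h : o.CycleReversal ω ω') :
    diff ω ω' ∈ o.flows := by
  obtain ⟨X, ⟨n, c, ⟨hmatch, -, hinj⟩, hω, rfl⟩, rfl⟩ := h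
  intro q
  have hval (i : Fin (n + 1)) : q (o.src (c i)) - q (o.src (c (i + 1))) =
      diff ω (reverse ω (range fun i => (c i).1)) (c i).1 * o.coboundary q (c i).1 := by
    rw [o.diff_reverse_mul_coboundary (mem_range_self i), ← hmatch i]
    have hi : c i = ((c i).1, ω (c i).1) := Prod.ext rfl (hω i).symm
    rw [← hi]
  rw [dotProduct, ← Fintype.sum_of_injective (fun i => (c i).1) hinj _ _
    (fun e he => by rw [diff_reverse_of_notMem he, zero_mul]) hval, Finset.sum_sub_distrib,
    sub_eq_zero]
  exact (Equiv.sum_comp (Equiv.addRight (1 : Fin (n + 1))) fun i => q (o.src (c i))).symm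

theorem CocycleReversal.diff_mem_tensions (h : o.CocycleReversal A B ω ω') :
    diff ω ω' ∈ o.tensions A B := by
  classical
  obtain ⟨X, ⟨-, U, rfl, hU, hABU, hABU'⟩, rfl⟩ := h
  refine ⟨U.indicator 1, fun x hx => ?_, funext fun e => ?_⟩
  · have := hABU x hx
    have := hABU' x hx
    simp only [indicator_apply, Pi.one_apply]
    grind
  · have hback := hU (e, ω e) rfl
    by_cases he : o.src (e, ω e) ∈ U ∧ o.tgt (e, ω e) ∉ U
    · have hmem := exists_mem_orientationArcs_iff (P := fun a => o.src a ∈ U ∧ o.tgt a ∉ U) |>.2 he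
      cases h : ω e <;> simp_all [diff, reverse, coboundary_apply, src, tgt]
    · rw [diff_reverse_of_notMem (mt exists_mem_orientationArcs_iff.1 he)]
      simp only [coboundary_apply, indicator_apply, Pi.one_apply]
      cases h : ω e <;> grind [src, tgt]

end FlowsAndTensions

section ReducedIsMaximal

variable {ω ω' : G.Orientation} {z : E(G) → ℤ} {p : V(G) → ℤ}

theorem abs_diff_le_one (ω ω' : G.Orientation) (e : E(G)) : |diff ω ω' e| ≤ 1 := by
  rw [diff]
  cases ω e <;> cases ω' e <;> decide

theorem diff_eq_zero_iff : diff ω ω' e = 0 ↔ ω e = ω' e := by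
  rw [diff]
  cases ω e <;> cases ω' e <;> decide

theorem mul_coboundary_nonpos (hz : z e = 0 ∨ z e = diff ω ω' e)
    (hp : p (o.src (e, ω e)) ≤ p (o.tgt (e, ω e))) : z e * o.coboundary p e ≤ 0 := by
  rcases hz with hz | hz
  · simp [hz]
  · rw [hz]
    cases h : ω e <;> cases h' : ω' e <;> simp_all [diff, coboundary_apply, src, tgt]

theorem le_of_coboundary_eq_zero_or_eq_diff
    (hp : o.coboundary p e = 0 ∨ o.coboundary p e = diff ω ω' e) :
    p (o.tgt (e, ω e)) ≤ p (o.src (e, ω e)) := by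
  rw [coboundary_apply, diff] at hp
  cases h : ω e <;> cases h' : ω' e <;> grind [src, tgt, Bool.toInt]

theorem eq_zero_or_coboundary_eq_zero [Fintype E(G)] (hz : z ∈ o.flows)
    (h : ∀ e, |z e + o.coboundary p e| ≤ 1) (e : E(G)) : z e = 0 ∨ o.coboundary p e = 0 := by
  classical
  by_contra! hne
  -- Where `p` crosses the level `t`, the bound forces `z` to have the opposite sign.
  let t := max (p (o.head e)) (p (o.tail e))
  let q : V(G) → ℤ := {v | t ≤ p v}.indicator 1
  have hq (j) : o.coboundary q j =
      (if t ≤ p (o.head j) then 1 else 0) - if t ≤ p (o.tail j) then 1 else 0 := by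
    simp [q, coboundary_apply, indicator_apply]
  have hle (j) : z j * o.coboundary q j ≤ 0 := by
    have hj := abs_le.1 (h j)
    rw [coboundary_apply] at hj
    rw [hq]
    split_ifs <;> lia
  have hzero := (Finset.sum_eq_zero_iff_of_nonpos fun j _ => hle j).1 (hz q) e (Finset.mem_univ e)
  have hqe := (mul_eq_zero.1 hzero).resolve_left hne.1
  rw [hq] at hqe
  have := hne.2
  rw [coboundary_apply] at this
  split_ifs at hqe <;> lia

variable [LinearOrder E(G)]

theorem flow_eq_zero_of_isCycleReduced [Fintype E(G)] (hω : o.IsCycleReduced (orientationArcs ω))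
    (hz : z ∈ o.flows) (hdiff : ∀ j, z j = 0 ∨ z j = diff ω ω' j) (hlt : ∀ j < e, ω j = ω' j)
    (he : ω e = false) : z e = 0 := by
  classical
  let S : Set V(G) := {x | ReflTransGen (o.deleteStep (Iic e) (orientationArcs ω)) (o.tail e) x}
  let q : V(G) → ℤ := S.indicator 1
  have htail : o.tail e ∈ S := .refl
  have hhead : o.head e ∉ S := hω e he
  have hle (j) : z j * o.coboundary q j ≤ 0 := by
    rcases lt_or_ge j e with hj | hj
    · have hzj : z j = 0 := (hdiff j).elim id fun h => h.trans (diff_eq_zero_iff.2 (hlt j hj))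
      simp [hzj]
    refine o.mul_coboundary_nonpos (hdiff j) ?_
    have hS : o.src (j, ω j) ∈ S → o.tgt (j, ω j) ∈ S := by
      rcases hj.eq_or_lt with rfl | hj
      · simp [he, tgt, htail]
      · exact fun hs => hs.tail (o.step_of_mem ⟨rfl, not_le.2 hj⟩)
    by_cases hs : o.src (j, ω j) ∈ S
    · simp [q, hs, hS hs]
    · by_cases ht : o.tgt (j, ω j) ∈ S <;> simp [q, hs, ht]
  have hzero := (Finset.sum_eq_zero_iff_of_nonpos fun j _ => hle j).1 (hz q) e (Finset.mem_univ e)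
  simpa [q, coboundary_apply, htail, hhead] using hzero

theorem coboundary_eq_zero_of_isCocycleReduced
    (hω : o.IsCocycleReduced A B (orientationArcs ω)) (hp : ∀ x ∈ A ∪ B, p x.1 = p x.2)
    (hdiff : ∀ j, o.coboundary p j = 0 ∨ o.coboundary p j = diff ω ω' j)
    (hlt : ∀ j < e, ω j = ω' j) (he : ω e = false) : o.coboundary p e = 0 := by
  have hstep : ∀ x y, o.contractStep A B (Iio e) (orientationArcs ω) x y → p y ≤ p x := by
    rintro _ _ (⟨⟨j, b⟩, hj | hj, rfl, rfl⟩ | hAB | hAB)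
    · obtain rfl : ω j = b := hj
      exact o.le_of_coboundary_eq_zero_or_eq_diff (hdiff j)
    · have hpj : o.coboundary p j = 0 :=
        (hdiff j).elim id fun h => h.trans (diff_eq_zero_iff.2 (hlt j hj))
      rw [coboundary_apply, sub_eq_zero] at hpj
      cases b <;> simp [src, tgt, hpj]
    · exact (hp _ hAB).ge
    · exact (hp _ hAB).le
  have hreach := ReflTransGen.lift (p := (· ≥ ·)) p hstep _ _ (hω e (by simp [orientationArcs, he]))
  have hle : p (o.head e) ≤ p (o.tail e) := by rwa [reflTransGen_eq_self] at hreach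
  have hge := o.le_of_coboundary_eq_zero_or_eq_diff (hdiff e)
  rw [he] at hge
  exact sub_eq_zero.2 (hle.antisymm hge)

theorem toLex_le_of_forall_diff_eq_zero [Finite E(G)]
    (h : ∀ e, (∀ j < e, ω j = ω' j) → ω e = false → diff ω ω' e = 0) :
    toLex ω' ≤ toLex ω := by
  refine not_lt.1 fun ⟨e, hlt, he⟩ => ?_
  obtain ⟨hω, hω'⟩ : ω e = false ∧ ω' e = true := Bool.lt_iff.1 he
  exact absurd (diff_eq_zero_iff.1 (h e hlt hω)) (by simp [hω, hω'])

variable {o}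

theorem IsCocycleReduced.toLex_le [Finite E(G)]
    (hω : o.IsCocycleReduced A B (orientationArcs ω)) (h : diff ω ω' ∈ o.tensions A B) :
    toLex ω' ≤ toLex ω := by
  obtain ⟨p, hp, hdiff⟩ := h
  exact toLex_le_of_forall_diff_eq_zero fun e hlt he => (congrFun hdiff e).symm.trans <|
    o.coboundary_eq_zero_of_isCocycleReduced hω hp (fun j => .inr (congrFun hdiff j)) hlt he

variable [Fintype E(G)]

theorem IsCycleReduced.toLex_le (hω : o.IsCycleReduced (orientationArcs ω))
    (h : diff ω ω' ∈ o.flows) : toLex ω' ≤ toLex ω :=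
  toLex_le_of_forall_diff_eq_zero fun _ hlt he =>
    o.flow_eq_zero_of_isCycleReduced hω h (fun _ => .inr rfl) hlt he

theorem IsCycleReduced.toLex_le_of_mem_sup (hcyc : o.IsCycleReduced (orientationArcs ω))
    (hcoc : o.IsCocycleReduced A B (orientationArcs ω))
    (h : diff ω ω' ∈ o.flows ⊔ o.tensions A B) : toLex ω' ≤ toLex ω := by
  obtain ⟨z, hz, _, ⟨p, hp, rfl⟩, hsum⟩ := AddSubgroup.mem_sup.1 h
  have hsum (j) : z j + o.coboundary p j = diff ω ω' j := congrFun hsum j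
  have hdisj := o.eq_zero_or_coboundary_eq_zero hz fun j => hsum j ▸ abs_diff_le_one ω ω' j
  have hz' (j) : z j = 0 ∨ z j = diff ω ω' j :=
    (hdisj j).imp_right fun hpj => by rw [← hsum, hpj, add_zero]
  have hp' (j) : o.coboundary p j = 0 ∨ o.coboundary p j = diff ω ω' j :=
    (hdisj j).symm.imp_right fun hzj => by rw [← hsum, hzj, zero_add]
  refine toLex_le_of_forall_diff_eq_zero fun e hlt he => ?_
  rw [← hsum e, o.flow_eq_zero_of_isCycleReduced hcyc hz hz' hlt he,
    o.coboundary_eq_zero_of_isCocycleReduced hcoc hp hp' hlt he, add_zero]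

end ReducedIsMaximal

section Counting

variable [Finite E(G)]

theorem numValidClasses_repeated_eq [LinearOrder E(G)] {r : G.Orientation → G.Orientation → Prop}
    (hr : ∀ {ω ω'}, r ω ω' → r ω' ω) {P : G.Orientation → Prop}
    (hvalid : ∀ {ω ω'}, r ω ω' →
      (o.IsValid A B (orientationArcs ω') ↔ o.IsValid A B (orientationArcs ω)))
    (hmax : ∀ ω, (∀ ω', r ω ω' → toLex ω' ≤ toLex ω) → P ω)
    (hP : ∀ {ω ω'}, P ω → ReflTransGen r ω ω' → toLex ω' ≤ toLex ω) :
    o.numValidClasses A B (repeated r hr) =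
      Nat.card {ω // o.IsValid A B (orientationArcs ω) ∧ P ω} := by
  have hiff (ω : o.ValidOrientation A B) :
      (∀ ω' : o.ValidOrientation A B, ReflTransGen r ω.1 ω'.1 → toLex ω'.1 ≤ toLex ω.1) ↔ P ω.1 :=
    ⟨fun h => hmax _ fun ω' hω' => h ⟨ω', (hvalid hω').2 ω.2⟩ (.single hω'),
      fun h _ hω' => hP h hω'⟩
  rw [numValidClasses, card_quotient_eq_card_maximal
    (f := fun ω : o.ValidOrientation A B => toLex ω.1) (toLex.injective.comp Subtype.val_injective)]
  exact Nat.card_congr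
    ((Equiv.subtypeEquivRight hiff).trans (Equiv.subtypeSubtypeEquivSubtypeInter _ _))

section Reduced

variable [LinearOrder E(G)]

theorem numValidClasses_cycleEquiv_eq_card_reduced :
    o.numValidClasses A B o.cycleEquiv =
      Nat.card {ω : G.Orientation // o.IsValid A B (orientationArcs ω) ∧
        o.IsCycleReduced (orientationArcs ω)} := by
  have := Fintype.ofFinite E(G)
  exact o.numValidClasses_repeated_eq o.cycleReversal_symm CycleReversal.isValid_iff
    (fun _ => o.isCycleReduced_of_forall_le)
    fun hω h => hω.toLex_le (diff_mem_of_reflTransGen CycleReversal.diff_mem_flows h)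

theorem numValidClasses_cocycleEquiv_eq_card_reduced :
    o.numValidClasses A B (o.cocycleEquiv A B) =
      Nat.card {ω : G.Orientation // o.IsValid A B (orientationArcs ω) ∧
        o.IsCocycleReduced A B (orientationArcs ω)} := by
  exact o.numValidClasses_repeated_eq (o.cocycleReversal_symm A B) CocycleReversal.isValid_iff
    (fun _ => o.isCocycleReduced_of_forall_le)
    fun hω h => hω.toLex_le (diff_mem_of_reflTransGen CocycleReversal.diff_mem_tensions h)

theorem numValidClasses_cycleCocycleEquiv_eq_card_reduced :
    o.numValidClasses A B (o.cycleCocycleEquiv A B) =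
      Nat.card {ω : G.Orientation // o.IsValid A B (orientationArcs ω) ∧
        o.IsCocycleReduced A B (orientationArcs ω) ∧ o.IsCycleReduced (orientationArcs ω)} := by
  have := Fintype.ofFinite E(G)
  refine o.numValidClasses_repeated_eq
    (fun h => h.imp o.cycleReversal_symm (o.cocycleReversal_symm A B))
    (fun h => h.elim CycleReversal.isValid_iff CocycleReversal.isValid_iff) ?_ ?_
  · exact fun ω h => ⟨o.isCocycleReduced_of_forall_le fun ω' h' => h ω' (.inr h'),
      o.isCycleReduced_of_forall_le fun ω' h' => h ω' (.inl h')⟩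
  · rintro ω ω' ⟨hcoc, hcyc⟩ h
    refine hcyc.toLex_le_of_mem_sup hcoc (diff_mem_of_reflTransGen (fun h' => ?_) h)
    exact h'.elim (fun hc => AddSubgroup.mem_sup_left hc.diff_mem_flows)
      fun hc => AddSubgroup.mem_sup_right hc.diff_mem_tensions

end Reduced

theorem numValidClasses_eq_card_subgraphs (A B : Set (V(G) × V(G))) :
    o.numValidClasses A B o.cycleEquiv =
        Nat.card {F : Set E(G) // o.IsValid A B (subgraphArcs F) ∧ o.IsForest F} ∧
      o.numValidClasses A B (o.cocycleEquiv A B) =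
        Nat.card {F : Set E(G) // o.IsValid A B (subgraphArcs F) ∧ IsABConnected A B F} ∧
      o.numValidClasses A B (o.cycleCocycleEquiv A B) =
        Nat.card {F : Set E(G) // o.IsValid A B (subgraphArcs F) ∧ IsABConnected A B F ∧
          o.IsForest F} := by
  let _ : LinearOrder E(G) := LinearOrder.lift' _ (Finite.equivFin E(G)).injective
  obtain ⟨φ, hφ⟩ := o.exists_equiv_reduced_iff A B
  have hvalid F := (hφ F).1.symm
  have hforest F := o.isForest_iff_isCycleReduced.trans (hφ F).2.1.symm
  have hconn F := o.isABConnected_iff_isCocycleReduced.trans (hφ F).2.2.symm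
  rw [o.numValidClasses_cycleEquiv_eq_card_reduced, o.numValidClasses_cocycleEquiv_eq_card_reduced,
    o.numValidClasses_cycleCocycleEquiv_eq_card_reduced]
  exact ⟨Nat.card_congr (φ.subtypeEquiv fun F => and_congr (hvalid F) (hforest F)).symm,
    Nat.card_congr (φ.subtypeEquiv fun F => and_congr (hvalid F) (hconn F)).symm,
    Nat.card_congr (φ.subtypeEquiv fun F =>
      and_congr (hvalid F) (and_congr (hconn F) (hforest F))).symm⟩

end Counting

section EmptyConstraints

theorem isValid_empty (D : Set G.Arc) : o.IsValid ∅ ∅ D :=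
  ⟨fun _ _ h => h.elim, fun _ _ h => h.elim⟩

theorem numValidClasses_empty (s : Setoid G.Orientation) :
    o.numValidClasses ∅ ∅ s = Nat.card (Quotient s) :=
  Nat.card_congr <|
    Quotient.congr (Equiv.subtypeUnivEquiv fun _ => o.isValid_empty _) fun _ _ => Iff.rfl

theorem isABConnected_empty_iff (hG : IsConnectedSubgraph (univ : Set E(G))) {F : Set E(G)} :
    IsABConnected ∅ ∅ F ↔ IsConnectedSubgraph F := by
  have hadj (F : Set E(G)) : AdjAdd ∅ ∅ F = fun x y : V(G) => ∃ e ∈ F, G.IsLink e x y := by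
    ext
    simp [AdjAdd]
  simp only [IsABConnected, hadj]
  exact ⟨fun h => ⟨hG.1, fun u v => (h u v).2 (hG.2 u v)⟩,
    fun h u v => iff_of_true (h.2 u v) (hG.2 u v)⟩

end EmptyConstraints

end Graph.RefOrientation

theorem corollary4_general {α β : Type*} (G : Graph α β) [Finite E(G)] (o : G.RefOrientation) :
    (∀ A B : Set (V(G) × V(G)),
      o.numValidClasses A B o.cycleEquiv =
          Nat.card {F : Set E(G) // o.IsValid A B (Graph.subgraphArcs F) ∧ o.IsForest F} ∧
      o.numValidClasses A B (o.cocycleEquiv A B) =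
          Nat.card {F : Set E(G) // o.IsValid A B (Graph.subgraphArcs F) ∧
            Graph.IsABConnected A B F} ∧
      o.numValidClasses A B (o.cycleCocycleEquiv A B) =
          Nat.card {F : Set E(G) // o.IsValid A B (Graph.subgraphArcs F) ∧
            Graph.IsABConnected A B F ∧ o.IsForest F}) ∧
    Nat.card (Quotient o.cycleEquiv) = Nat.card {F : Set E(G) // o.IsForest F} ∧
    (Graph.IsConnectedSubgraph (Set.univ : Set E(G)) →
      Nat.card (Quotient (o.cocycleEquiv ∅ ∅)) =
          Nat.card {F : Set E(G) // Graph.IsConnectedSubgraph F} ∧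
      Nat.card (Quotient (o.cycleCocycleEquiv ∅ ∅)) =
          Nat.card {F : Set E(G) // Graph.IsConnectedSubgraph F ∧ o.IsForest F}) := by
  refine ⟨o.numValidClasses_eq_card_subgraphs, ?_⟩
  obtain ⟨hcyc, hcoc, hboth⟩ := o.numValidClasses_eq_card_subgraphs ∅ ∅
  simp only [o.numValidClasses_empty, o.isValid_empty, true_and] at hcyc hcoc hboth
  refine ⟨hcyc, fun hG => ?_⟩
  simp only [Graph.RefOrientation.isABConnected_empty_iff hG] at hcoc hboth
  exact ⟨hcoc, hboth⟩

theorem corollary4 {α β : Type*} (G : Graph α β) [Finite V(G)] [Finite E(G)]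
    (o : G.RefOrientation) :
    (∀ A B : Set (V(G) × V(G)),
      o.numValidClasses A B o.cycleEquiv =
          Nat.card {F : Set E(G) // o.IsValid A B (Graph.subgraphArcs F) ∧ o.IsForest F} ∧
      o.numValidClasses A B (o.cocycleEquiv A B) =
          Nat.card {F : Set E(G) // o.IsValid A B (Graph.subgraphArcs F) ∧
            Graph.IsABConnected A B F} ∧
      o.numValidClasses A B (o.cycleCocycleEquiv A B) =
          Nat.card {F : Set E(G) // o.IsValid A B (Graph.subgraphArcs F) ∧
            Graph.IsABConnected A B F ∧ o.IsForest F}) ∧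
    Nat.card (Quotient o.cycleEquiv) = Nat.card {F : Set E(G) // o.IsForest F} ∧
    (Graph.IsConnectedSubgraph (Set.univ : Set E(G)) →
      Nat.card (Quotient (o.cocycleEquiv ∅ ∅)) =
          Nat.card {F : Set E(G) // Graph.IsConnectedSubgraph F} ∧
      Nat.card (Quotient (o.cycleCocycleEquiv ∅ ∅)) =
          Nat.card {F : Set E(G) // Graph.IsConnectedSubgraph F ∧ o.IsForest F}) := by
  exact corollary4_general G o
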